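/- Let $S$ be a finite state space with its discrete $\sigma$-field, and write $P(s'|s)$ for the entries of a transition kernel $P$ on $S$. For an initial distribution $\mu$ on $S$ let $P_\mu^{P}$ and $E_\mu^{P}$ be the probability and expectation under which $(X_n)_{n\ge 0}$ is the Markov chain with $X_0\sim\mu$ and transition kernel $P$. For $C\subseteq S$ let $P|_C=(P(s'|s))_{s,s'\in C}$. Fix parameters $\gamma(s'|s)>0$, $s,s'\in S$, and let $\Pi$ be the product Dirichlet prior with parameter $\gamma$, i.e. the law of a random matrix $\Phi\in\mathbb{R}^{S\times S}$ with independent rows $\Phi(\cdot|s)\sim\mathrm{Dirichlet}(\gamma(\cdot|s))$. Let $P_0$ be a transition kernel on $S$. For $n\ge1$ define the mixture likelihood ratio $$\Lambda_n:=\int\prod_{t=0}^{n-1}\frac{Q(X_{t+1}|X_t)}{P_0(X_{t+1}|X_t)}\,\Pi(dQ),\qquad q/0:=+\infty\ \text{ for } q>0,$$ and, for $\rho\in(0,1)$, the rejection time $$\tau_\rho:=\inf\{n\ge1:\ P_0(X_n|X_{n-1})=0\ \text{ or }\ \Lambda_n\ge 1/\rho\},\qquad \inf\varnothing:=\infty.$$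 Theorem. Suppose that $P_0$ is unichain, i.e. it has exactly one closed communicating class $C_0\subseteq S$ (possibly together with transient states). 1. For every initial distribution $\mu$ and every $\rho\in(0,1)$, $P_\mu^{P_0}(\tau_\rho<\infty)\le\rho$. 2. Let $P$ be a transition kernel on $S$ with $P|_{C_0}\ne P_0|_{C_0}$. Then there is a constant $K<\infty$, depending only on $(P,P_0,\gamma)$, such that for every initial distribution $\mu$ and every $\rho\in(0,1)$, $$E_\mu^{P}\tau_\rho\le K\left(\log\frac1\rho+1\right).$$ -/

import Mathlib

open MeasureTheory ProbabilityTheory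
open scoped ENNReal

namespace MarkovTest

variable {S : Type*}

section Chain

variable [MeasurableSpace S]

/-- The law on path space `S^ℕ` of the time-homogeneous Markov chain with initial distribution `μ`
and transition kernel `P`: the state at time `n + 1` is drawn from `P` at the state at time `n`.
The chain itself is the coordinate process `X n ω = ω n`. -/
noncomputable def chainLaw (μ : Measure S) (P : Kernel S S) [IsMarkovKernel P] :
    Measure (ℕ → S) :=
  Kernel.trajMeasure (X := fun _ : ℕ => S) μ
    (fun n => P.comap (fun x : (Finset.Iic n → S) => x ⟨n, Finset.mem_Iic.mpr le_rfl⟩)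
      (measurable_pi_apply _))

/-- `s'` is accessible from `s`: there is a (possibly empty) path of transitions of positive
probability from `s` to `s'`. -/
def Accessible (P : Kernel S S) : S → S → Prop :=
  Relation.ReflTransGen (fun a b => 0 < P a {b})

/-- `C` is a communicating class: an equivalence class of mutual accessibility. -/
def IsCommunicatingClass (P : Kernel S S) (C : Set S) : Prop :=
  ∃ s, C = {s' | Accessible P s s' ∧ Accessible P s' s}

/-- `C` is closed: the chain cannot leave it. -/
def IsClosedUnder (P : Kernel S S) (C : Set S) : Prop :=
  ∀ s ∈ C, P s Cᶜ = 0

/-- The set of all closed communicating classes of `P`. -/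
def closedClasses (P : Kernel S S) : Set (Set S) :=
  {C | IsCommunicatingClass P C ∧ IsClosedUnder P C}

/-- `P` viewed as a matrix, with entry `P(s' | s)` in row `s` and column `s'`. -/
noncomputable def kernelMatrix (P : Kernel S S) : Matrix S S ℝ :=
  fun s s' => (P s).real {s'}

/-- The principal submatrix of `P` indexed by `C × C`. -/
noncomputable def subKernel (P : Kernel S S) (C : Set S) : Matrix C C ℝ :=
  (kernelMatrix P).submatrix Subtype.val Subtype.val

end Chain

section Prior

variable [Fintype S]

/-- The Dirichlet distribution with parameters `a s > 0`, as the law of a vector of independent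
`Gamma(a s, 1)` variables divided by its sum. -/
noncomputable def dirichlet (a : S → ℝ) : Measure (S → ℝ) :=
  (Measure.pi fun s => gammaMeasure (a s) 1).map (fun g s => g s / ∑ s', g s')

/-- The product Dirichlet prior: the law of a random matrix with independent rows, row `s` having
the Dirichlet distribution with parameters `γ s`. -/
noncomputable def productDirichlet (γ : S → S → ℝ) : Measure (S → S → ℝ) :=
  Measure.pi fun s => dirichlet (γ s)

end Prior

section Test

variable [MeasurableSpace S]

/-- The mixture likelihood ratio of the path `ω` at time `n`, for the null kernel `P₀` and the
prior `Pi`. In `ℝ≥0∞` one has `q / 0 = ∞` for `q > 0`. -/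
noncomputable def mixtureLR (P₀ : Kernel S S) (Pi : Measure (S → S → ℝ)) (n : ℕ) (ω : ℕ → S) :
    ℝ≥0∞ :=
  ∫⁻ Q, ∏ t ∈ Finset.range n, ENNReal.ofReal (Q (ω t) (ω (t + 1))) / P₀ (ω t) {ω (t + 1)} ∂Pi

/-- The rejection time with threshold `1 / ρ`: the least `n ≥ 1` at which the last transition is
impossible under `P₀` or the mixture likelihood ratio is at least `1 / ρ`; it is `⊤` if there is no
such `n`. -/
noncomputable def rejectionTime (P₀ : Kernel S S) (Pi : Measure (S → S → ℝ)) (ρ : ℝ) (ω : ℕ → S) :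
    ℕ∞ :=
  ⨅ (n : ℕ) (_ : 1 ≤ n ∧
    (P₀ (ω (n - 1)) {ω n} = 0 ∨ ENNReal.ofReal (1 / ρ) ≤ mixtureLR P₀ Pi n ω)), (n : ℕ∞)

end Test

end MarkovTest

/-!
# Validity and expected rejection time of the mixture likelihood ratio test

*Validity.* Under the null kernel `P₀` the mixture likelihood ratio is a nonnegative supermartingale
started at one (`sum_mul_lintegral_le_mixtureLR`), and impossible transitions almost surely do not
occur, so Ville's inequality (`ville_inequality`) bounds the probability of ever rejecting by `ρ`.

*Expected rejection time.* The prior gives mass `c > 0` to the matrices `Q ≥ θ² P`, entrywise, for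
any `θ < 1` (`productDirichlet_dominating_pos`); this one-sided domination is possible even where
`P` has zero entries. Hence `Λ n ≥ c θ^(2n) ∏ P/P₀` along every path, and a path that has not been
rejected by time `n` satisfies `1 ≤ (√c √ρ θ^n)⁻¹ ∏ √(P₀/P)`. The expectation of `∏ √(P₀/P)` under
`P` is computed by the `n`-th power of the Hellinger matrix `A = √(P P₀)`, applied to the constant
vector `1` (`lintegral_chainLaw_prod_sqrtInvLR`).

The rows of `A` sum to at most one, with equality only where the rows of `P` and `P₀` agree. If all
row sums equal one on a nonempty set that `A` does not leave, then `P = P₀` on the rows of that set,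
and `P₀` does not leave it either. It therefore contains a closed communicating class of `P₀`, which
can only be `C₀`, so that `P` and `P₀` agree on `C₀`, against the assumption. Without such a set, the
powers of `A` decay like `r^n` for some `r < 1` (`exists_geometric_decay`). Choosing
`r < r' < 1` and `θ = r / r'` gives `ℙ(τ > n) ≤ (C / √c) ρ^(-1/2) r'^n`, and the sum over `n` of the
minimum of this bound and one is at most linear in `log (1 / ρ)` (`exists_tsum_min_one_le`).
-/

namespace MarkovTest

/-! ### The Markov property on path space -/

section PathSpace

variable {S : Type*}

/-- The infinite path that follows `x` up to time `n` and then stays at its last state. -/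
def extendPath (n : ℕ) (x : Finset.Iic n → S) : ℕ → S :=
  fun t => x ⟨min t n, Finset.mem_Iic.mpr (min_le_right t n)⟩

theorem apply_extendPath_frestrictLe {β : Type*} {f : (ℕ → S) → β} {n : ℕ}
    (hf : DependsOn f (Set.Iic n)) (ω : ℕ → S) :
    f (extendPath n (Preorder.frestrictLe n ω)) = f ω :=
  hf fun t ht => by simp [extendPath, min_eq_left (Set.mem_Iic.mp ht)]

theorem dependsOn_prod_range {M : Type*} [CommMonoid M] (h : S → S → M) (n : ℕ) :
    DependsOn (fun ω : ℕ → S => ∏ t ∈ Finset.range n, h (ω t) (ω (t + 1))) (Set.Iic n) := by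
  intro ω ω' hω
  refine Finset.prod_congr rfl fun t ht => ?_
  have ht' := Finset.mem_range.mp ht
  rw [hω t (Set.mem_Iic.mpr ht'.le), hω (t + 1) (Set.mem_Iic.mpr ht')]

variable [Fintype S] [MeasurableSpace S] [DiscreteMeasurableSpace S]

theorem measurable_of_dependsOn_Iic {β : Type*} [MeasurableSpace β] {f : (ℕ → S) → β} {n : ℕ}
    (hf : DependsOn f (Set.Iic n)) : Measurable f := by
  have h : f = (fun x => f (extendPath n x)) ∘ Preorder.frestrictLe n :=
    funext fun ω => (apply_extendPath_frestrictLe hf ω).symm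
  rw [h]
  exact (measurable_of_finite _).comp (Preorder.measurable_frestrictLe n)

theorem sum_kernel_singleton (P : Kernel S S) [IsMarkovKernel P] (s : S) :
    ∑ s', P s {s'} = 1 := by
  simp

variable (μ : Measure S) [IsProbabilityMeasure μ] (P : Kernel S S) [IsMarkovKernel P]

instance : IsProbabilityMeasure (chainLaw μ P) := by
  unfold chainLaw
  infer_instance

/-- The Markov property: given the path up to time `n`, the state at time `n + 1` has law
`P (ω n)`. -/
theorem lintegral_chainLaw_succ {n : ℕ} {F : (ℕ → S) → S → ℝ≥0∞}
    (hF : DependsOn F (Set.Iic n)) :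
    ∫⁻ ω, F ω (ω (n + 1)) ∂chainLaw μ P
      = ∫⁻ ω, ∑ s, P (ω n) {s} * F ω s ∂chainLaw μ P := by
  have hG : Measurable fun p : (Finset.Iic n → S) × S => F (extendPath n p.1) p.2 :=
    measurable_of_finite _
  have key := congrArg
    (fun ν => ∫⁻ p : (Finset.Iic n → S) × S, F (extendPath n p.1) p.2 ∂ν)
    (Kernel.map_frestrictLe_trajMeasure_compProd_eq_map_trajMeasure
    (X := fun _ : ℕ => S) (μ₀ := μ) (a := n)
    (κ := fun n => P.comap (fun x : (Finset.Iic n → S) => x ⟨n, Finset.mem_Iic.mpr le_rfl⟩)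
      (measurable_pi_apply _)))
  change ∫⁻ p, _ ∂(Measure.map _ (chainLaw μ P) ⊗ₘ _) = ∫⁻ p, _ ∂(Measure.map _ (chainLaw μ P))
    at key
  rw [Measure.lintegral_compProd hG, lintegral_map (measurable_of_finite _) (by fun_prop),
    lintegral_map hG (by fun_prop)] at key
  simp only [apply_extendPath_frestrictLe hF] at key
  rw [← key]
  refine lintegral_congr fun ω => ?_
  rw [lintegral_fintype]
  exact Finset.sum_congr rfl fun s _ => mul_comm _ _

/-- Almost surely, the chain only makes transitions of positive probability. -/
theorem ae_chainLaw_transition_ne_zero :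
    ∀ᵐ ω ∂chainLaw μ P, ∀ t, P (ω t) {ω (t + 1)} ≠ 0 := by
  rw [ae_all_iff]
  intro n
  have h := lintegral_chainLaw_succ μ P (n := n)
    (F := fun ω s => Set.indicator {s | P (ω n) {s} = 0} 1 s)
    (fun ω ω' hω => by simp only [hω n (Set.mem_Iic.mpr le_rfl)])
  have h0 : ∀ ω : ℕ → S, ∑ s, P (ω n) {s} * Set.indicator {s | P (ω n) {s} = 0} 1 s = 0 := by
    intro ω
    refine Finset.sum_eq_zero fun s _ => ?_
    by_cases hs : P (ω n) {s} = 0 <;> simp [hs]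
  simp only [h0, lintegral_zero] at h
  have hm : Measurable fun ω : ℕ → S =>
      Set.indicator {s | P (ω n) {s} = 0} (1 : S → ℝ≥0∞) (ω (n + 1)) :=
    measurable_of_dependsOn_Iic (n := n + 1) fun ω ω' hω => by
      rw [hω n (by simp), hω (n + 1) (by simp)]
  filter_upwards [(lintegral_eq_zero_iff hm).mp h] with ω hω h0
  simp [Set.indicator, h0] at hω

end PathSpace

/-! ### Ville's inequality -/

section Ville

/-- Ville's maximal inequality: `Λ` is a nonnegative supermartingale, with the supermartingale
property stated on every event of the form `{Λ 1 < c, …, Λ n < c}`. -/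
theorem ville_inequality {Ω : Type*} [MeasurableSpace Ω] (ν : Measure Ω) {Λ : ℕ → Ω → ℝ≥0∞}
    (hm : ∀ n, Measurable (Λ n)) (h0 : ∫⁻ ω, Λ 0 ω ∂ν ≤ 1) (c : ℝ≥0∞)
    (hstep : ∀ n, ∫⁻ ω in {ω | ∀ k, 1 ≤ k → k ≤ n → Λ k ω < c}, Λ (n + 1) ω ∂ν
      ≤ ∫⁻ ω in {ω | ∀ k, 1 ≤ k → k ≤ n → Λ k ω < c}, Λ n ω ∂ν) :
    c * ν {ω | ∃ n, 1 ≤ n ∧ c ≤ Λ n ω} ≤ 1 := by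
  set A : ℕ → Set Ω := fun n => {ω | ∀ k, 1 ≤ k → k ≤ n → Λ k ω < c} with hA
  have hAm : ∀ n, MeasurableSet (A n) := fun n => by
    have : A n = ⋂ k, ⋂ (_ : 1 ≤ k), ⋂ (_ : k ≤ n), {ω | Λ k ω < c} := by
      ext ω; simp [hA]
    rw [this]
    exact .iInter fun k => .iInter fun _ => .iInter fun _ => measurableSet_lt (hm k) measurable_const
  have hanti : Antitone A := fun m n hmn ω hω k hk hkm => hω k hk (hkm.trans hmn)
  have hind : ∀ n, c * ν (A n)ᶜ + ∫⁻ ω in A n, Λ n ω ∂ν ≤ 1 := by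
    intro n
    induction n with
    | zero =>
      have : A 0 = Set.univ := by
        ext ω; simp only [hA, Set.mem_ofPred_eq, Set.mem_univ, iff_true]; intro k; omega
      simpa [this] using h0
    | succ n ih =>
      refine le_trans ?_ ih
      have hsub : A (n + 1) ⊆ A n := hanti n.le_succ
      have hcompl : (A (n + 1))ᶜ = (A n)ᶜ ∪ (A n \ A (n + 1)) := by
        ext ω
        have := @hsub ω
        simp only [Set.mem_compl_iff, Set.mem_union, Set.mem_sdiff]
        tauto
      have hsplit : ∫⁻ ω in A n, Λ (n + 1) ω ∂ν
          = ∫⁻ ω in A (n + 1), Λ (n + 1) ω ∂ν + ∫⁻ ω in A n \ A (n + 1), Λ (n + 1) ω ∂ν := by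
        rw [← lintegral_inter_add_sdiff _ (A n) (hAm (n + 1)),
          Set.inter_eq_self_of_subset_right hsub]
      -- on `A n \ A (n + 1)` the level `c` is passed exactly at time `n + 1`
      have hcross : c * ν (A n \ A (n + 1)) ≤ ∫⁻ ω in A n \ A (n + 1), Λ (n + 1) ω ∂ν := by
        rw [← setLIntegral_const]
        refine setLIntegral_mono (hm _) fun ω hω => ?_
        by_contra hlt
        refine hω.2 fun k hk hkn => ?_
        rcases Nat.lt_or_ge n k with h | h
        · obtain rfl : k = n + 1 := by omega
          exact not_le.mp hlt
        · exact hω.1 k hk h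
      calc c * ν (A (n + 1))ᶜ + ∫⁻ ω in A (n + 1), Λ (n + 1) ω ∂ν
          ≤ c * (ν (A n)ᶜ + ν (A n \ A (n + 1))) + ∫⁻ ω in A (n + 1), Λ (n + 1) ω ∂ν := by
            rw [hcompl]; gcongr; exact measure_union_le _ _
        _ ≤ c * ν (A n)ᶜ + (∫⁻ ω in A (n + 1), Λ (n + 1) ω ∂ν
              + ∫⁻ ω in A n \ A (n + 1), Λ (n + 1) ω ∂ν) := by
            rw [mul_add, add_assoc, add_comm (c * ν (A n \ A (n + 1)))]; gcongr
        _ ≤ c * ν (A n)ᶜ + ∫⁻ ω in A n, Λ n ω ∂ν := by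
            rw [← hsplit]; exact add_le_add le_rfl (hstep n)
  have hU : {ω | ∃ n, 1 ≤ n ∧ c ≤ Λ n ω} = ⋃ n, (A n)ᶜ := by
    ext ω
    simp only [hA, Set.mem_ofPred_eq, Set.mem_iUnion, Set.mem_compl_iff, not_forall, not_lt]
    exact ⟨fun ⟨n, h1, h2⟩ => ⟨n, n, h1, le_rfl, h2⟩, fun ⟨_, k, h1, _, h2⟩ => ⟨k, h1, h2⟩⟩
  have hmono : Monotone fun n => (A n)ᶜ := fun m n hmn => Set.compl_subset_compl.mpr (hanti hmn)
  rw [hU, hmono.measure_iUnion, ENNReal.mul_iSup]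
  exact iSup_le fun n => le_self_add.trans (hind n)

end Ville

/-! ### Dirichlet laws -/

section Dirichlet

theorem gammaMeasure_Ioo_pos {a r u v : ℝ} (ha : 0 < a) (hr : 0 < r) (hu : 0 ≤ u) (huv : u < v) :
    0 < gammaMeasure a r (Set.Ioo u v) := by
  rw [gammaMeasure, withDensity_apply _ measurableSet_Ioo,
    setLIntegral_pos_iff (by unfold gammaPDF; fun_prop)]
  have : Function.support (gammaPDF a r) ∩ Set.Ioo u v = Set.Ioo u v :=
    Set.inter_eq_right.mpr fun x hx =>
      (ENNReal.ofReal_pos.mpr (gammaPDFReal_pos ha hr (hu.trans_lt hx.1))).ne'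
  simpa [this] using huv

theorem ae_gammaMeasure_nonneg (a r : ℝ) : ∀ᵐ x ∂gammaMeasure a r, 0 ≤ x := by
  rw [gammaMeasure, ae_withDensity_iff (by unfold gammaPDF; fun_prop)]
  refine .of_forall fun x hx => ?_
  by_contra! h
  exact hx (gammaPDF_of_neg h)

variable {S : Type*} [Fintype S]

theorem measurable_div_sum : Measurable fun (g : S → ℝ) s => g s / ∑ s', g s' := by
  fun_prop

theorem isProbabilityMeasure_dirichlet {a : S → ℝ} (ha : ∀ s, 0 < a s) :
    IsProbabilityMeasure (dirichlet a) := by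
  have := fun s => isProbabilityMeasure_gammaMeasure (ha s) one_pos
  exact Measure.isProbabilityMeasure_map measurable_div_sum.aemeasurable

theorem isProbabilityMeasure_productDirichlet {γ : S → S → ℝ} (hγ : ∀ s s', 0 < γ s s') :
    IsProbabilityMeasure (productDirichlet γ) := by
  have := fun s => isProbabilityMeasure_dirichlet (hγ s)
  unfold productDirichlet
  infer_instance

theorem ae_dirichlet_sum_ofReal_le_one {a : S → ℝ} (ha : ∀ s, 0 < a s) :
    ∀ᵐ q ∂dirichlet a, ∑ s, ENNReal.ofReal (q s) ≤ 1 := by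
  have := fun s => isProbabilityMeasure_gammaMeasure (ha s) one_pos
  rw [dirichlet, ae_map_iff measurable_div_sum.aemeasurable
    (measurableSet_le (by fun_prop) measurable_const)]
  have h : ∀ᵐ g ∂Measure.pi fun s => gammaMeasure (a s) 1, ∀ s, 0 ≤ g s :=
    ae_all_iff.mpr fun s =>
      (Measure.tendsto_eval_ae_ae (i := s)).eventually (ae_gammaMeasure_nonneg (a s) 1)
  filter_upwards [h] with g hg
  rw [← ENNReal.ofReal_sum_of_nonneg
    fun s _ => div_nonneg (hg s) (Finset.sum_nonneg fun s' _ => hg s'), ← Finset.sum_div]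
  exact ENNReal.ofReal_le_one.mpr (div_self_le_one _)

theorem ae_productDirichlet_sum_ofReal_le_one {γ : S → S → ℝ} (hγ : ∀ s s', 0 < γ s s') :
    ∀ᵐ Q ∂productDirichlet γ, ∀ s, ∑ s', ENNReal.ofReal (Q s s') ≤ 1 := by
  have := fun s => isProbabilityMeasure_dirichlet (hγ s)
  unfold productDirichlet
  exact ae_all_iff.mpr fun s =>
    (Measure.tendsto_eval_ae_ae (μ := fun s => dirichlet (γ s)) (i := s)).eventually
      (ae_dirichlet_sum_ofReal_le_one (hγ s))

/-- A Dirichlet law charges the set of vectors that dominate `θ p`, for `θ < 1` and any probability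
vector `p`, including one on the boundary of the simplex. -/
theorem dirichlet_dominating_pos {a : S → ℝ} (ha : ∀ s, 0 < a s) {p : S → ℝ}
    (hp : ∀ s, 0 ≤ p s) (hp1 : ∑ s, p s = 1) {θ : ℝ} (hθ0 : 0 ≤ θ) (hθ1 : θ < 1) :
    0 < dirichlet a {q | ∀ s, θ * p s ≤ q s} := by
  have := fun s => isProbabilityMeasure_gammaMeasure (ha s) one_pos
  set k : ℝ := (Fintype.card S : ℝ)
  have hk : 0 ≤ k := Nat.cast_nonneg _
  -- with this `δ`, an enlargement of `p` by at most `2 δ` per entry has sum at most `2 - θ`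
  set δ : ℝ := (1 - θ) / (2 * (k + 1)) with hδ
  have hδ0 : 0 < δ := div_pos (by linarith) (by linarith)
  have hkδ : k * (2 * δ) ≤ 1 - θ := by
    have : (k + 1) * (2 * δ) = 1 - θ := by rw [hδ]; field_simp
    nlinarith
  have hmeas : MeasurableSet {q : S → ℝ | ∀ s, θ * p s ≤ q s} := by
    rw [Set.ofPred_forall]
    exact .iInter fun s => measurableSet_le measurable_const (measurable_pi_apply s)
  rw [dirichlet, Measure.map_apply measurable_div_sum hmeas]
  have hbox : 0 < Measure.pi (fun s => gammaMeasure (a s) 1)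
      (Set.univ.pi fun s => Set.Ioo (p s + δ) (p s + 2 * δ)) := by
    rw [Measure.pi_pi]
    exact pos_iff_ne_zero.mpr (Finset.prod_ne_zero_iff.mpr fun s _ =>
      (gammaMeasure_Ioo_pos (ha s) one_pos (by linarith [hp s]) (by linarith)).ne')
  refine hbox.trans_le (measure_mono fun g hg s => ?_)
  have hg1 : ∀ s, p s + δ < g s := fun s => (hg s (Set.mem_univ s)).1
  have hg2 : ∀ s, g s < p s + 2 * δ := fun s => (hg s (Set.mem_univ s)).2
  have hsum : ∑ s, g s ≤ 2 - θ := by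
    calc ∑ s, g s ≤ ∑ s, (p s + 2 * δ) := Finset.sum_le_sum fun s _ => (hg2 s).le
      _ = 1 + k * (2 * δ) := by simp [Finset.sum_add_distrib, hp1, k]
      _ ≤ 2 - θ := by linarith
  have hgpos : ∀ s, 0 < g s := fun s => by linarith [hp s, hg1 s]
  have hpos : 0 < ∑ s, g s := Finset.sum_pos (fun s _ => hgpos s) ⟨s, Finset.mem_univ s⟩
  rw [le_div_iff₀ hpos]
  calc θ * p s * ∑ s, g s ≤ θ * p s * (2 - θ) :=
        mul_le_mul_of_nonneg_left hsum (mul_nonneg hθ0 (hp s))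
    _ = p s - p s * (1 - θ) ^ 2 := by ring
    _ ≤ g s := by nlinarith [hp s, hg1 s, mul_nonneg (hp s) (sq_nonneg (1 - θ))]

theorem productDirichlet_dominating_pos {γ : S → S → ℝ} (hγ : ∀ s s', 0 < γ s s')
    {p : S → S → ℝ} (hp : ∀ s s', 0 ≤ p s s') (hp1 : ∀ s, ∑ s', p s s' = 1)
    {θ : ℝ} (hθ0 : 0 ≤ θ) (hθ1 : θ < 1) :
    0 < productDirichlet γ {Q | ∀ s s', θ * p s s' ≤ Q s s'} := by
  have := fun s => isProbabilityMeasure_dirichlet (hγ s)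
  have h : {Q : S → S → ℝ | ∀ s s', θ * p s s' ≤ Q s s'}
      = Set.univ.pi fun s => {q | ∀ s', θ * p s s' ≤ q s'} := by
    ext; simp
  rw [h, productDirichlet, Measure.pi_pi]
  exact pos_iff_ne_zero.mpr (Finset.prod_ne_zero_iff.mpr fun s _ =>
    (dirichlet_dominating_pos (hγ s) (hp s) (hp1 s) hθ0 hθ1).ne')

end Dirichlet

/-! ### The supermartingale property under the null kernel -/

section Validity

variable {S : Type*} [MeasurableSpace S]

theorem dependsOn_mixtureLR (P₀ : Kernel S S) (ν : Measure (S → S → ℝ)) (n : ℕ) :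
    DependsOn (mixtureLR P₀ ν n) (Set.Iic n) := fun _ _ hω =>
  lintegral_congr fun Q =>
    dependsOn_prod_range (fun a b => ENNReal.ofReal (Q a b) / P₀ a {b}) n hω

theorem mixtureLR_zero (P₀ : Kernel S S) (ν : Measure (S → S → ℝ)) [IsProbabilityMeasure ν]
    (ω : ℕ → S) : mixtureLR P₀ ν 0 ω = 1 := by
  simp [mixtureLR]

variable [Fintype S]

/-- Averaging the next likelihood ratio over the null transition does not increase it. It may
decrease it, since the mass that the mixture gives to impossible transitions is lost. -/
theorem sum_mul_lintegral_le_mixtureLR (P₀ : Kernel S S) [IsMarkovKernel P₀]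
    {ν : Measure (S → S → ℝ)}
    (hPi : ∀ᵐ Q ∂ν, ∀ s, ∑ s', ENNReal.ofReal (Q s s') ≤ 1) (n : ℕ) (ω : ℕ → S) :
    ∑ s, P₀ (ω n) {s} * ∫⁻ Q, (∏ t ∈ Finset.range n,
        ENNReal.ofReal (Q (ω t) (ω (t + 1))) / P₀ (ω t) {ω (t + 1)})
          * (ENNReal.ofReal (Q (ω n) s) / P₀ (ω n) {s}) ∂ν
      ≤ mixtureLR P₀ ν n ω := by
  have hm : ∀ s, Measurable fun Q : S → S → ℝ => (∏ t ∈ Finset.range n,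
        ENNReal.ofReal (Q (ω t) (ω (t + 1))) / P₀ (ω t) {ω (t + 1)})
          * (ENNReal.ofReal (Q (ω n) s) / P₀ (ω n) {s}) := fun s => by fun_prop
  simp_rw [← lintegral_const_mul _ (hm _)]
  rw [← lintegral_finsetSum _ fun s _ => (hm s).const_mul _, mixtureLR]
  refine lintegral_mono_ae ?_
  filter_upwards [hPi] with Q hQ
  calc _ = (∏ t ∈ Finset.range n, ENNReal.ofReal (Q (ω t) (ω (t + 1))) / P₀ (ω t) {ω (t + 1)})
        * ∑ s, P₀ (ω n) {s} * (ENNReal.ofReal (Q (ω n) s) / P₀ (ω n) {s}) := by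
        rw [Finset.mul_sum]
        exact Finset.sum_congr rfl fun s _ => mul_left_comm _ _ _
    _ ≤ (∏ t ∈ Finset.range n, ENNReal.ofReal (Q (ω t) (ω (t + 1))) / P₀ (ω t) {ω (t + 1)})
        * ∑ s, ENNReal.ofReal (Q (ω n) s) := by
        gcongr with s
        exact ENNReal.mul_div_le
    _ ≤ _ := mul_le_of_le_one_right' (hQ _)

variable [DiscreteMeasurableSpace S]

/-- Under the null kernel, the mixture likelihood ratio exceeds `c` at some time with probability
at most `1 / c`. -/
theorem mul_chainLaw_exists_le_mixtureLR_le_one (μ : Measure S) [IsProbabilityMeasure μ]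
    (P₀ : Kernel S S) [IsMarkovKernel P₀] {ν : Measure (S → S → ℝ)} [IsProbabilityMeasure ν]
    (hPi : ∀ᵐ Q ∂ν, ∀ s, ∑ s', ENNReal.ofReal (Q s s') ≤ 1) (c : ℝ≥0∞) :
    c * chainLaw μ P₀ {ω | ∃ n, 1 ≤ n ∧ c ≤ mixtureLR P₀ ν n ω} ≤ 1 := by
  refine ville_inequality _ (fun n => measurable_of_dependsOn_Iic (dependsOn_mixtureLR P₀ ν n))
    (by simp [mixtureLR_zero]) c fun n => ?_
  set A : Set (ℕ → S) := {ω | ∀ k, 1 ≤ k → k ≤ n → mixtureLR P₀ ν k ω < c} with hA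
  have hAdep : ∀ ω ω' : ℕ → S, (∀ t ∈ Set.Iic n, ω t = ω' t) → (ω ∈ A ↔ ω' ∈ A) :=
    fun ω ω' h => forall₃_congr fun k _ hk => by
      rw [dependsOn_mixtureLR P₀ ν k fun t ht => h t (le_trans ht hk)]
  have hAm : MeasurableSet A := measurableSet_setOfPred.mpr
    (measurable_of_dependsOn_Iic (n := n) fun ω ω' h => propext (hAdep ω ω' h))
  set F : (ℕ → S) → S → ℝ≥0∞ := fun ω s => A.indicator 1 ω * ∫⁻ Q, (∏ t ∈ Finset.range n,
        ENNReal.ofReal (Q (ω t) (ω (t + 1))) / P₀ (ω t) {ω (t + 1)})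
          * (ENNReal.ofReal (Q (ω n) s) / P₀ (ω n) {s}) ∂ν with hF
  have hFdep : DependsOn F (Set.Iic n) := fun ω ω' h => by
    have h1 : A.indicator (1 : (ℕ → S) → ℝ≥0∞) ω = A.indicator 1 ω' := by
      simp only [Set.indicator, hAdep ω ω' h, Pi.one_apply]
    funext s
    simp only [hF, h1, h n (Set.mem_Iic.mpr le_rfl)]
    congr 1
    refine lintegral_congr fun Q => ?_
    exact congrArg (· * (ENNReal.ofReal (Q (ω' n) s) / P₀ (ω' n) {s}))
      (dependsOn_prod_range (fun a b => ENNReal.ofReal (Q a b) / P₀ a {b}) n h)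
  have hsucc : ∀ ω, F ω (ω (n + 1)) = A.indicator (mixtureLR P₀ ν (n + 1)) ω := fun ω => by
    by_cases h : ω ∈ A <;> simp [hF, h, mixtureLR, Finset.prod_range_succ]
  rw [← lintegral_indicator hAm, ← lintegral_indicator hAm]
  simp_rw [← hsucc]
  rw [lintegral_chainLaw_succ μ P₀ hFdep]
  refine lintegral_mono fun ω => ?_
  by_cases h : ω ∈ A
  · simpa [hF, h] using sum_mul_lintegral_le_mixtureLR P₀ hPi n ω
  · simp [hF, h]

theorem chainLaw_rejectionTime_lt_top_le (μ : Measure S) [IsProbabilityMeasure μ]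
    (P₀ : Kernel S S) [IsMarkovKernel P₀] {ν : Measure (S → S → ℝ)} [IsProbabilityMeasure ν]
    (hPi : ∀ᵐ Q ∂ν, ∀ s, ∑ s', ENNReal.ofReal (Q s s') ≤ 1) {ρ : ℝ} (hρ : 0 < ρ) :
    chainLaw μ P₀ {ω | rejectionTime P₀ ν ρ ω < ⊤} ≤ ENNReal.ofReal ρ := by
  have hle : chainLaw μ P₀ {ω | rejectionTime P₀ ν ρ ω < ⊤} ≤
      chainLaw μ P₀ {ω | ∃ n, 1 ≤ n ∧ ENNReal.ofReal (1 / ρ) ≤ mixtureLR P₀ ν n ω} := by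
    refine measure_mono_ae ?_
    filter_upwards [ae_chainLaw_transition_ne_zero μ P₀] with ω hω hτ
    change rejectionTime P₀ ν ρ ω < ⊤ at hτ
    simp only [rejectionTime, iInf_lt_iff] at hτ
    obtain ⟨n, ⟨hn, h | h⟩, -⟩ := hτ
    · refine absurd h ?_
      simpa [Nat.sub_add_cancel hn] using hω (n - 1)
    · exact ⟨n, hn, h⟩
  have hc : ENNReal.ofReal ρ * ENNReal.ofReal (1 / ρ) = 1 := by
    rw [← ENNReal.ofReal_mul hρ.le, mul_one_div_cancel hρ.ne', ENNReal.ofReal_one]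
  calc _ ≤ _ := hle
    _ = ENNReal.ofReal ρ * (ENNReal.ofReal (1 / ρ) * chainLaw μ P₀
          {ω | ∃ n, 1 ≤ n ∧ ENNReal.ofReal (1 / ρ) ≤ mixtureLR P₀ ν n ω}) := by
        rw [← mul_assoc, hc, one_mul]
    _ ≤ ENNReal.ofReal ρ := mul_le_of_le_one_right'
        (mul_chainLaw_exists_le_mixtureLR_le_one μ P₀ hPi _)

end Validity

/-! ### Geometric decay of substochastic matrices -/

section Substochastic

open Matrix

variable {S : Type*} [Fintype S]

/-- The iterates of a nonnegative matrix preserve the pointwise order. The bound has the form `B * w`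
so that it covers scaling as well. -/
theorem iterate_mulVec_le {A : Matrix S S ℝ} (hA : ∀ i j, 0 ≤ A i j) {u w : S → ℝ} {B : ℝ}
    (h : ∀ i, u i ≤ B * w i) (m : ℕ) (i : S) : (A.mulVec^[m] u) i ≤ B * (A.mulVec^[m] w) i := by
  induction m generalizing i with
  | zero => exact h i
  | succ m ih =>
    rw [Function.iterate_succ_apply', Function.iterate_succ_apply', mulVec, mulVec, dotProduct,
      dotProduct, Finset.mul_sum]
    exact Finset.sum_le_sum fun j _ =>
      (mul_le_mul_of_nonneg_left (ih j) (hA i j)).trans_eq (mul_left_comm _ _ _)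

theorem iterate_mulVec_nonneg {A : Matrix S S ℝ} (hA : ∀ i j, 0 ≤ A i j) {u : S → ℝ}
    (hu : ∀ i, 0 ≤ u i) (m : ℕ) (i : S) : 0 ≤ (A.mulVec^[m] u) i := by
  induction m generalizing i with
  | zero => exact hu i
  | succ m ih =>
    rw [Function.iterate_succ_apply']
    exact Finset.sum_nonneg fun j _ => mul_nonneg (hA i j) (ih j)

/-- The powers of a finite substochastic matrix decay geometrically unless its rows sum to one on
some nonempty set of indices that it does not leave. -/
theorem exists_geometric_decay {A : Matrix S S ℝ} (hA : ∀ i j, 0 ≤ A i j)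
    (hrow : ∀ i, ∑ j, A i j ≤ 1)
    (hesc : ∀ D : Set S, (∀ i ∈ D, ∑ j, A i j = 1) → (∀ i ∈ D, ∀ j, 0 < A i j → j ∈ D) → D = ∅) :
    ∃ C r : ℝ, 1 ≤ C ∧ 0 < r ∧ r < 1 ∧ ∀ n i, (A.mulVec^[n] 1) i ≤ C * r ^ n := by
  set v : ℕ → S → ℝ := fun n => A.mulVec^[n] 1 with hv
  have hsucc : ∀ n i, v (n + 1) i = ∑ j, A i j * v n j := fun n i => by
    simp only [hv, Function.iterate_succ_apply']; rfl
  have hv1 : ∀ i, v 1 i = ∑ j, A i j := fun i => by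
    rw [hsucc 0]; simp [hv]
  have hanti : ∀ i, Antitone fun n => v n i := fun i => antitone_nat_of_succ_le fun n => by
    have := iterate_mulVec_le hA (u := v 1) (w := 1) (B := 1)
      (fun i => by simpa [hv1] using hrow i) n i
    rw [one_mul] at this
    simpa only [hv, Function.iterate_add_apply] using this
  have hle : ∀ n i, v n i ≤ 1 := fun n i => hanti i (Nat.zero_le n)
  -- the indices from which no mass is ever lost
  have hD := hesc {i | ∀ n, v n i = 1} (fun i hi => by rw [← hv1]; exact hi 1)
    fun i hi j hij n => by
      have h1 : ∑ j, A i j = 1 := by rw [← hv1]; exact hi 1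
      have h2 : ∑ j, A i j * v n j = ∑ j, A i j := by rw [← hsucc, h1]; exact hi (n + 1)
      have h3 := (Finset.sum_eq_sum_iff_of_le fun j _ =>
        mul_le_of_le_one_right (hA i j) (hle n j)).mp h2 j (Finset.mem_univ j)
      exact mul_left_cancel₀ hij.ne' (h3.trans (mul_one _).symm)
  have hlt : ∀ i, ∃ n, v n i < 1 := fun i => by
    by_contra! h
    have : i ∈ {i | ∀ n, v n i = 1} := fun n => le_antisymm (hle n i) (h n)
    rw [hD] at this
    exact this
  choose N hN using hlt
  set m := ∑ i, N i + 1 with hm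
  have hvm : ∀ i, v m i < 1 := fun i => (hanti i ((Finset.single_le_sum
    (fun _ _ => Nat.zero_le _) (Finset.mem_univ i)).trans (Nat.le_succ _))).trans_lt (hN i)
  obtain ⟨r₀, hr₀, hr₁, hvr⟩ : ∃ r₀ : ℝ, 0 < r₀ ∧ r₀ < 1 ∧ ∀ i, v m i ≤ r₀ := by
    rcases isEmpty_or_nonempty S with hS | hS
    · exact ⟨1 / 2, by norm_num, by norm_num, fun i => hS.elim i⟩
    · obtain ⟨i₀, hi₀⟩ := Finite.exists_max (v m)
      exact ⟨max (v m i₀) (1 / 2), by positivity, max_lt (hvm i₀) (by norm_num),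
        fun i => (hi₀ i).trans (le_max_left _ _)⟩
  -- Bernoulli's inequality gives `r₀ ≤ r ^ m` for this `r`
  have hm1 : (1 : ℝ) ≤ m := by exact_mod_cast Nat.le_add_left 1 (∑ i, N i)
  set r : ℝ := 1 - (1 - r₀) / m with hr
  have hx0 : 0 < (1 - r₀) / m := div_pos (by linarith) (by linarith)
  have hx1 : (1 - r₀) / m ≤ 1 - r₀ := div_le_self (by linarith) hm1
  have hr0 : 0 < r := by linarith
  have hrm : r₀ ≤ r ^ m := by
    have h := one_add_mul_le_pow (a := -((1 - r₀) / m)) (by linarith) m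
    have h' : (m : ℝ) * -((1 - r₀) / m) = -(1 - r₀) := by field_simp
    rw [h', ← sub_eq_add_neg 1 ((1 - r₀) / m)] at h
    linarith
  have hrm0 : 0 < r ^ m := pow_pos hr0 m
  refine ⟨(r ^ m)⁻¹, r, (one_le_inv₀ hrm0).mpr (pow_le_one₀ hr0.le (by linarith)), hr0,
    by linarith, fun n => ?_⟩
  induction n using Nat.strong_induction_on with
  | _ n ih =>
    intro i
    rcases lt_or_ge n m with hn | hn
    · refine (hle n i).trans ?_
      rw [inv_mul_eq_div, one_le_div hrm0]
      exact pow_le_pow_of_le_one hr0.le (by linarith) hn.le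
    · obtain ⟨l, rfl⟩ := Nat.exists_eq_add_of_le hn
      have hl : l < m + l := by omega
      have h := iterate_mulVec_le hA (u := v l) (w := 1)
        (fun i => by simpa using ih l hl i) m i
      calc (A.mulVec^[m + l] 1) i = (A.mulVec^[m] (v l)) i := by
            rw [Function.iterate_add_apply]
        _ ≤ (r ^ m)⁻¹ * r ^ l * v m i := h
        _ ≤ (r ^ m)⁻¹ * r ^ l * r ^ m := by gcongr; exact (hvr i).trans hrm
        _ = (r ^ m)⁻¹ * r ^ (m + l) := by ring

end Substochastic

/-! ### Hellinger affinity -/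

section Hellinger

variable {S : Type*} [Fintype S]

theorem sum_sqrt_sub_sqrt_sq {p q : S → ℝ} (hp : ∀ i, 0 ≤ p i) (hq : ∀ i, 0 ≤ q i)
    (hp1 : ∑ i, p i = 1) (hq1 : ∑ i, q i = 1) :
    ∑ i, (√(p i) - √(q i)) ^ 2 = 2 - 2 * ∑ i, √(p i * q i) := by
  have h : ∀ i, (√(p i) - √(q i)) ^ 2 = p i + q i - 2 * √(p i * q i) := fun i => by
    rw [sub_sq, Real.sq_sqrt (hp i), Real.sq_sqrt (hq i), Real.sqrt_mul (hp i)]; ring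
  simp only [h, Finset.sum_sub_distrib, Finset.sum_add_distrib, hp1, hq1, Finset.mul_sum]
  ring

theorem sum_sqrt_mul_le_one {p q : S → ℝ} (hp : ∀ i, 0 ≤ p i) (hq : ∀ i, 0 ≤ q i)
    (hp1 : ∑ i, p i = 1) (hq1 : ∑ i, q i = 1) : ∑ i, √(p i * q i) ≤ 1 := by
  have h := sum_sqrt_sub_sqrt_sq hp hq hp1 hq1
  have : 0 ≤ ∑ i, (√(p i) - √(q i)) ^ 2 := Finset.sum_nonneg fun i _ => sq_nonneg _
  linarith

theorem eq_of_sum_sqrt_mul_eq_one {p q : S → ℝ} (hp : ∀ i, 0 ≤ p i) (hq : ∀ i, 0 ≤ q i)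
    (hp1 : ∑ i, p i = 1) (hq1 : ∑ i, q i = 1) (h1 : ∑ i, √(p i * q i) = 1) : p = q := by
  have h := sum_sqrt_sub_sqrt_sq hp hq hp1 hq1
  rw [h1, mul_one, sub_self, Finset.sum_eq_zero_iff_of_nonneg fun i _ => sq_nonneg _] at h
  funext i
  exact (Real.sqrt_inj (hp i) (hq i)).mp (sub_eq_zero.mp (pow_eq_zero_iff two_ne_zero |>.mp
    (h i (Finset.mem_univ i))))

end Hellinger

/-! ### Closed communicating classes -/

section ClosedClasses

variable {S : Type*} [Fintype S] [MeasurableSpace S]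

/-- A nonempty set that the chain cannot leave contains a closed communicating class: the states
accessible from `d`, for a state `d` of the set from which the fewest states are accessible. -/
theorem exists_closedClass_subset (P : Kernel S S) {D : Set S} (hne : D.Nonempty)
    (hD : ∀ s ∈ D, ∀ s', 0 < P s {s'} → s' ∈ D) : ∃ C ∈ closedClasses P, C ⊆ D := by
  obtain ⟨d, hd, hmin⟩ := Set.exists_min_image D
    (fun s => {t | Accessible P s t}.ncard) D.toFinite hne
  have hacc : ∀ s, Accessible P d s → s ∈ D := fun s hs => by
    induction hs with
    | refl => exact hd
    | tail _ h ih => exact hD _ ih _ h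
  have hback : ∀ s, Accessible P d s → Accessible P s d := fun s hs => by
    have hsub : {t | Accessible P s t} ⊆ {t | Accessible P d t} := fun t ht => hs.trans ht
    have heq := Set.eq_of_subset_of_ncard_le hsub (hmin s (hacc s hs)) (Set.toFinite _)
    have : d ∈ {t | Accessible P d t} := Relation.ReflTransGen.refl
    rwa [← heq] at this
  refine ⟨{s | Accessible P d s ∧ Accessible P s d}, ⟨⟨d, rfl⟩, fun s hs => ?_⟩,
    fun s hs => hacc s hs.1⟩
  rw [← Set.biUnion_of_singleton {s | Accessible P d s ∧ Accessible P s d}ᶜ,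
    measure_biUnion_null_iff (Set.to_countable _)]
  intro t ht
  by_contra h
  have : Accessible P d t := hs.1.tail (pos_iff_ne_zero.mpr h)
  exact ht ⟨this, hback t this⟩

end ClosedClasses

/-! ### Summing capped geometric tails -/

section Tail

/-- The terms of `∑ min 1 (x r ^ n)` are at most one until `x r ^ n` falls below one, which takes
`log x / log (1 / r)` steps, and are dominated by a geometric series from there on. -/
theorem tsum_min_one_geometric_le {x r : ℝ} (hx : 1 ≤ x) (hr0 : 0 < r) (hr1 : r < 1) :
    ∑' n : ℕ, min 1 (ENNReal.ofReal (x * r ^ n))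
      ≤ ENNReal.ofReal (Real.log x / -Real.log r + 1 + (1 - r)⁻¹) := by
  have hl0 : 0 < -Real.log r := neg_pos.mpr (Real.log_neg hr0 hr1)
  have hx0 : 0 < x := one_pos.trans_le hx
  have hlogx : 0 ≤ Real.log x := Real.log_nonneg hx
  have hr' : 0 < (1 - r)⁻¹ := inv_pos.mpr (sub_pos.mpr hr1)
  obtain ⟨N, hN1, hN2⟩ : ∃ N : ℕ, (N : ℝ) ≤ Real.log x / -Real.log r + 1 ∧ x * r ^ N ≤ 1 := by
    refine ⟨⌈Real.log x / -Real.log r⌉₊, (Nat.ceil_lt_add_one (by positivity)).le, ?_⟩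
    have h := (div_le_iff₀ hl0).mp (Nat.le_ceil (Real.log x / -Real.log r))
    rw [← Real.log_nonpos_iff (by positivity), Real.log_mul hx0.ne' (pow_pos hr0 _).ne',
      Real.log_pow]
    rw [mul_neg] at h
    linarith
  have h1 : ∑ n ∈ Finset.range N, min 1 (ENNReal.ofReal (x * r ^ n)) ≤ ENNReal.ofReal N := by
    refine (Finset.sum_le_sum fun n _ => min_le_left 1 _).trans ?_
    simp
  have h2 : ∑' n : ℕ, min 1 (ENNReal.ofReal (x * r ^ (n + N))) ≤ ENNReal.ofReal (1 - r)⁻¹ := by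
    rw [← tsum_geometric_of_lt_one hr0.le hr1, ENNReal.ofReal_tsum_of_nonneg
      (fun n => (pow_pos hr0 n).le) (summable_geometric_of_lt_one hr0.le hr1)]
    refine ENNReal.tsum_le_tsum fun n => (min_le_right _ _).trans (ENNReal.ofReal_le_ofReal ?_)
    calc x * r ^ (n + N) = r ^ n * (x * r ^ N) := by rw [pow_add]; ring
      _ ≤ r ^ n := mul_le_of_le_one_right (pow_pos hr0 n).le hN2
  rw [← ENNReal.summable.sum_add_tsum_nat_add' (k := N)]
  refine (add_le_add h1 h2).trans ?_
  rw [← ENNReal.ofReal_add (Nat.cast_nonneg N) hr'.le]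
  exact ENNReal.ofReal_le_ofReal (by linarith)

theorem exists_tsum_min_one_le {M r : ℝ} (hM : 1 ≤ M) (hr0 : 0 < r) (hr1 : r < 1) :
    ∃ K : ℝ, ∀ ρ : ℝ, 0 < ρ → ρ < 1 →
      ∑' n : ℕ, min 1 (ENNReal.ofReal (M / √ρ * r ^ n))
        ≤ ENNReal.ofReal (K * (Real.log (1 / ρ) + 1)) := by
  have hl0 : 0 < -Real.log r := neg_pos.mpr (Real.log_neg hr0 hr1)
  have hlogM : 0 ≤ Real.log M := Real.log_nonneg hM
  have hr' : 0 < (1 - r)⁻¹ := inv_pos.mpr (sub_pos.mpr hr1)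
  refine ⟨(Real.log M + 1) / -Real.log r + 1 + (1 - r)⁻¹, fun ρ hρ0 hρ1 => ?_⟩
  have hsρ : 0 < √ρ := Real.sqrt_pos.mpr hρ0
  have hy0 : 0 ≤ Real.log (1 / ρ) := Real.log_nonneg (by rw [le_div_iff₀ hρ0]; linarith)
  have hL : Real.log (M / √ρ) = Real.log M + Real.log (1 / ρ) / 2 := by
    rw [Real.log_div (by linarith) hsρ.ne', Real.log_sqrt hρ0.le, one_div, Real.log_inv]
    ring
  have h1 : 1 ≤ M / √ρ := by
    rw [one_le_div hsρ]
    exact (Real.sqrt_le_one.mpr hρ1.le).trans hM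
  refine (tsum_min_one_geometric_le h1 hr0 hr1).trans (ENNReal.ofReal_le_ofReal ?_)
  generalize Real.log (1 / ρ) = y at hL hy0
  have h3 : Real.log (M / √ρ) / -Real.log r ≤ (Real.log M + 1) / -Real.log r * (y + 1) := by
    rw [div_mul_eq_mul_div, hL]
    refine div_le_div_of_nonneg_right ?_ hl0.le
    linarith [mul_nonneg hlogM hy0]
  linarith [mul_nonneg hr'.le hy0]

end Tail

/-! ### Tail bound for the rejection time -/

section Power

variable {S : Type*} [MeasurableSpace S]

theorem kernelMatrix_nonneg (P : Kernel S S) (s s' : S) : 0 ≤ kernelMatrix P s s' :=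
  measureReal_nonneg

theorem ofReal_kernelMatrix (P : Kernel S S) [IsMarkovKernel P] (s s' : S) :
    ENNReal.ofReal (kernelMatrix P s s') = P s {s'} :=
  ofReal_measureReal

theorem kernelMatrix_eq_zero_iff (P : Kernel S S) [IsMarkovKernel P] (s s' : S) :
    kernelMatrix P s s' = 0 ↔ P s {s'} = 0 :=
  measureReal_eq_zero_iff

/-- The matrix `√(P(s'|s) P₀(s'|s))`, whose row sums are the Hellinger affinities of the rows of
`P` and `P₀`. -/
noncomputable def hellingerMatrix (P P₀ : Kernel S S) : Matrix S S ℝ :=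
  fun s s' => √(kernelMatrix P s s' * kernelMatrix P₀ s s')

/-- The square root of the inverse likelihood ratio `P₀(s'|s) / P(s'|s)` of a transition. -/
noncomputable def sqrtInvLR (P P₀ : Kernel S S) (s s' : S) : ℝ :=
  √(kernelMatrix P₀ s s' / kernelMatrix P s s')

theorem sqrtInvLR_nonneg (P P₀ : Kernel S S) (s s' : S) : 0 ≤ sqrtInvLR P P₀ s s' :=
  Real.sqrt_nonneg _

theorem kernelMatrix_mul_sqrtInvLR (P P₀ : Kernel S S) (s s' : S) :
    kernelMatrix P s s' * sqrtInvLR P P₀ s s' = hellingerMatrix P P₀ s s' := by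
  have ha := kernelMatrix_nonneg P s s'
  rw [hellingerMatrix, sqrtInvLR]
  rcases ha.eq_or_lt with h | h
  · simp [← h]
  · nth_rewrite 1 [← Real.sqrt_sq ha]
    rw [← Real.sqrt_mul (sq_nonneg _)]
    congr 1
    field_simp

/-- The mixture likelihood ratio is bounded below by the part of the prior on matrices that
dominate `p`. -/
theorem mul_prod_le_mixtureLR (P₀ : Kernel S S) (ν : Measure (S → S → ℝ)) (p : S → S → ℝ)
    (n : ℕ) (ω : ℕ → S) :
    ν {Q | ∀ s s', p s s' ≤ Q s s'} * ∏ t ∈ Finset.range n,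
        (ENNReal.ofReal (p (ω t) (ω (t + 1))) / P₀ (ω t) {ω (t + 1)})
      ≤ mixtureLR P₀ ν n ω := by
  rw [mul_comm, ← setLIntegral_const]
  refine le_trans (setLIntegral_mono (by fun_prop) fun Q hQ => ?_) (setLIntegral_le_lintegral _ _)
  gcongr with t
  exact hQ _ _

/-- Before rejection, the root likelihood ratio of `P₀` to `P` along the path has not yet fallen
below a constant multiple of `√ρ θ ^ n`. -/
theorem sqrt_mul_pow_le_prod_of_lt_rejectionTime (P P₀ : Kernel S S) [IsMarkovKernel P]
    [IsMarkovKernel P₀] (ν : Measure (S → S → ℝ)) [IsProbabilityMeasure ν]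
    {θ ρ : ℝ} (hθ : 0 ≤ θ) (hρ0 : 0 < ρ) (hρ1 : ρ < 1) {ω : ℕ → S}
    (hω : ∀ t, P (ω t) {ω (t + 1)} ≠ 0) {n : ℕ} (hn : (n : ℕ∞) < rejectionTime P₀ ν ρ ω) :
    √(ν.real {Q | ∀ s s', θ ^ 2 * kernelMatrix P s s' ≤ Q s s'}) * √ρ * θ ^ n
      ≤ ∏ t ∈ Finset.range n, sqrtInvLR P P₀ (ω t) (ω (t + 1)) := by
  set c := ν.real {Q | ∀ s s', θ ^ 2 * kernelMatrix P s s' ≤ Q s s'} with hc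
  have hc0 : 0 ≤ c := measureReal_nonneg
  rcases Nat.eq_zero_or_pos n with rfl | hn1
  · have h1 : √c ≤ 1 := Real.sqrt_le_one.mpr measureReal_le_one
    have h2 : √ρ ≤ 1 := Real.sqrt_le_one.mpr hρ1.le
    simpa using mul_le_one₀ h1 (Real.sqrt_nonneg _) h2
  have hnot : ∀ k, 1 ≤ k → k ≤ n → P₀ (ω (k - 1)) {ω k} ≠ 0 ∧
      mixtureLR P₀ ν k ω < ENNReal.ofReal (1 / ρ) := by
    intro k hk hkn
    by_contra h
    rw [not_and_or, not_not, not_lt] at h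
    exact absurd ((iInf₂_le k ⟨hk, h⟩).trans (Nat.cast_le.mpr hkn)) (not_le.mpr hn)
  have hb : ∀ t ∈ Finset.range n, 0 < kernelMatrix P₀ (ω t) (ω (t + 1)) := fun t ht =>
    (kernelMatrix_nonneg _ _ _).lt_of_ne' fun h =>
      (hnot (t + 1) (by omega) (Finset.mem_range.mp ht)).1
        (by simpa using (kernelMatrix_eq_zero_iff P₀ _ _).mp h)
  have ha : ∀ t, 0 < kernelMatrix P (ω t) (ω (t + 1)) := fun t =>
    (kernelMatrix_nonneg _ _ _).lt_of_ne' fun h => hω t ((kernelMatrix_eq_zero_iff P _ _).mp h)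
  set L := ∏ t ∈ Finset.range n,
    (θ ^ 2 * kernelMatrix P (ω t) (ω (t + 1)) / kernelMatrix P₀ (ω t) (ω (t + 1))) with hL
  set H := ∏ t ∈ Finset.range n, sqrtInvLR P P₀ (ω t) (ω (t + 1)) with hH
  have hlt : c * L < 1 / ρ := by
    rw [← ENNReal.ofReal_lt_ofReal_iff (by positivity)]
    refine lt_of_le_of_lt ?_ (hnot n hn1 le_rfl).2
    refine le_trans (le_of_eq ?_)
      (mul_prod_le_mixtureLR P₀ ν (fun s s' => θ ^ 2 * kernelMatrix P s s') n ω)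
    rw [ENNReal.ofReal_mul hc0, hc, ofReal_measureReal, hL,
      ENNReal.ofReal_prod_of_nonneg fun t ht =>
        div_nonneg (mul_nonneg (sq_nonneg θ) (ha t).le) (hb t ht).le]
    congr 1
    refine Finset.prod_congr rfl fun t ht => ?_
    rw [ENNReal.ofReal_div_of_pos (hb t ht), ofReal_kernelMatrix P₀]
  have hLH : L * H ^ 2 = θ ^ (2 * n) := by
    rw [hL, hH, ← Finset.prod_pow, ← Finset.prod_mul_distrib, pow_mul]
    refine (Finset.prod_congr rfl fun t ht => ?_).trans
      (by rw [Finset.prod_const, Finset.card_range])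
    have := ha t
    have := hb t ht
    rw [sqrtInvLR, Real.sq_sqrt (by positivity)]
    field_simp
  have hH0 : 0 ≤ H := Finset.prod_nonneg fun t _ => sqrtInvLR_nonneg P P₀ _ _
  rw [← pow_le_pow_iff_left₀ (by positivity) hH0 two_ne_zero, mul_pow, mul_pow, Real.sq_sqrt hc0,
    Real.sq_sqrt hρ0.le, ← pow_mul, mul_comm n 2, ← hLH]
  calc c * ρ * (L * H ^ 2) = c * L * ρ * H ^ 2 := by ring
    _ ≤ H ^ 2 := mul_le_of_le_one_left (sq_nonneg H) ((lt_div_iff₀ hρ0).mp hlt).le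

theorem toENNReal_le_tsum (τ : ℕ∞) : (τ : ℝ≥0∞) ≤ ∑' n : ℕ, if (n : ℕ∞) < τ then 1 else 0 := by
  induction τ using ENat.recTopCoe with
  | top => simp
  | coe k =>
    refine le_trans ?_ (ENNReal.sum_le_tsum (Finset.range k))
    rw [Finset.sum_congr rfl fun n hn => if_pos (Nat.cast_lt.mpr (Finset.mem_range.mp hn))]
    simp

variable [Fintype S] [DiscreteMeasurableSpace S]

theorem sum_kernelMatrix (P : Kernel S S) [IsMarkovKernel P] (s : S) :
    ∑ s', kernelMatrix P s s' = 1 := by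
  rw [← ENNReal.ofReal_eq_ofReal_iff (Finset.sum_nonneg fun s' _ => kernelMatrix_nonneg P s s')
    zero_le_one, ENNReal.ofReal_sum_of_nonneg fun s' _ => kernelMatrix_nonneg P s s']
  simp only [ofReal_kernelMatrix, sum_kernel_singleton, ENNReal.ofReal_one]

/-- On a set of states that the Hellinger matrix does not leave and on which its rows sum to one,
`P` and `P₀` agree and `P₀` does not leave it. Such a set contains `C₀` unless it is empty. -/
theorem exists_hellingerMatrix_decay (P P₀ : Kernel S S) [IsMarkovKernel P] [IsMarkovKernel P₀]
    {C₀ : Set S} (hC₀ : closedClasses P₀ = {C₀}) (hne : subKernel P C₀ ≠ subKernel P₀ C₀) :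
    ∃ C r : ℝ, 1 ≤ C ∧ 0 < r ∧ r < 1 ∧
      ∀ n s, ((hellingerMatrix P P₀).mulVec^[n] 1) s ≤ C * r ^ n := by
  refine exists_geometric_decay (fun _ _ => Real.sqrt_nonneg _)
    (fun s => sum_sqrt_mul_le_one (kernelMatrix_nonneg P s) (kernelMatrix_nonneg P₀ s)
      (sum_kernelMatrix P s) (sum_kernelMatrix P₀ s)) fun D hsum hclosed => ?_
  have hrow : ∀ s ∈ D, kernelMatrix P s = kernelMatrix P₀ s := fun s hs =>
    eq_of_sum_sqrt_mul_eq_one (kernelMatrix_nonneg P s) (kernelMatrix_nonneg P₀ s)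
      (sum_kernelMatrix P s) (sum_kernelMatrix P₀ s) (hsum s hs)
  by_contra hD
  obtain ⟨C, hC, hCD⟩ := exists_closedClass_subset P₀ (Set.nonempty_iff_ne_empty.mpr hD)
    fun s hs s' hs' => by
      have hpos : 0 < kernelMatrix P₀ s s' :=
        (kernelMatrix_nonneg P₀ s s').lt_of_ne'
          fun h => hs'.ne' ((kernelMatrix_eq_zero_iff P₀ s s').mp h)
      refine hclosed s hs s' (Real.sqrt_pos.mpr ?_)
      rw [hrow s hs]
      exact mul_pos hpos hpos
  rw [hC₀, Set.mem_singleton_iff] at hC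
  subst hC
  refine hne ?_
  ext s s'
  exact congrFun (hrow s (hCD s.2)) s'

/-- The expectation under `P` of a product of inverse root likelihood ratios is a power of the
Hellinger matrix. -/
theorem lintegral_chainLaw_prod_sqrtInvLR (μ : Measure S) [IsProbabilityMeasure μ]
    (P P₀ : Kernel S S) [IsMarkovKernel P] (n : ℕ) {u : S → ℝ} (hu : ∀ s, 0 ≤ u s) :
    ∫⁻ ω, (∏ t ∈ Finset.range n, ENNReal.ofReal (sqrtInvLR P P₀ (ω t) (ω (t + 1))))
        * ENNReal.ofReal (u (ω n)) ∂chainLaw μ P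
      = ∫⁻ ω, ENNReal.ofReal (((hellingerMatrix P P₀).mulVec^[n] u) (ω 0)) ∂chainLaw μ P := by
  have hA : ∀ s s', 0 ≤ hellingerMatrix P P₀ s s' := fun _ _ => Real.sqrt_nonneg _
  induction n generalizing u with
  | zero => simp
  | succ n ih =>
    have hstep : ∀ s, ∑ s', P s {s'} * (ENNReal.ofReal (sqrtInvLR P P₀ s s')
        * ENNReal.ofReal (u s')) = ENNReal.ofReal ((hellingerMatrix P P₀).mulVec u s) := fun s => by
      rw [Matrix.mulVec, dotProduct,
        ENNReal.ofReal_sum_of_nonneg fun s' _ => mul_nonneg (hA s s') (hu s')]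
      refine Finset.sum_congr rfl fun s' _ => ?_
      rw [ENNReal.ofReal_mul (hA s s'), ← kernelMatrix_mul_sqrtInvLR,
        ENNReal.ofReal_mul (kernelMatrix_nonneg P s s'), ofReal_kernelMatrix, mul_assoc]
    have hAu : ∀ s, 0 ≤ (hellingerMatrix P P₀).mulVec u s := iterate_mulVec_nonneg hA hu 1
    rw [Function.iterate_succ_apply, ← ih hAu]
    simp_rw [Finset.prod_range_succ, mul_assoc]
    rw [lintegral_chainLaw_succ μ P (n := n) (F := fun ω s =>
      (∏ t ∈ Finset.range n, ENNReal.ofReal (sqrtInvLR P P₀ (ω t) (ω (t + 1))))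
        * (ENNReal.ofReal (sqrtInvLR P P₀ (ω n) s) * ENNReal.ofReal (u s)))
      fun ω ω' h => by
        funext s
        simp only [h n (Set.mem_Iic.mpr le_rfl)]
        exact congrArg (· * _)
          (dependsOn_prod_range (fun a b => ENNReal.ofReal (sqrtInvLR P P₀ a b)) n h)]
    refine lintegral_congr fun ω => ?_
    rw [← hstep, Finset.mul_sum]
    exact Finset.sum_congr rfl fun s _ => mul_left_comm _ _ _

theorem exists_lintegral_rejectionTime_le {γ : S → S → ℝ} (hγ : ∀ s s', 0 < γ s s')
    (P P₀ : Kernel S S) [IsMarkovKernel P] [IsMarkovKernel P₀]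
    {C₀ : Set S} (hC₀ : closedClasses P₀ = {C₀}) (hne : subKernel P C₀ ≠ subKernel P₀ C₀) :
    ∃ K : ℝ, ∀ (μ : Measure S) [IsProbabilityMeasure μ] (ρ : ℝ), 0 < ρ → ρ < 1 →
      ∫⁻ ω, (rejectionTime P₀ (productDirichlet γ) ρ ω : ℝ≥0∞) ∂(chainLaw μ P)
        ≤ ENNReal.ofReal (K * (Real.log (1 / ρ) + 1)) := by
  have := isProbabilityMeasure_productDirichlet hγ
  obtain ⟨C, r, hC, hr0, hr1, hdecay⟩ := exists_hellingerMatrix_decay P P₀ hC₀ hne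
  -- the loss `θ` per step in the mixture uses up only part of the decay rate `r`
  obtain ⟨r', hr, hr'⟩ := exists_between hr1
  have hr'0 : 0 < r' := hr0.trans hr
  set θ := r / r' with hθ
  have hθ0 : 0 < θ := div_pos hr0 hr'0
  have hθ1 : θ < 1 := (div_lt_one hr'0).mpr hr
  set c := (productDirichlet γ).real {Q | ∀ s s', θ ^ 2 * kernelMatrix P s s' ≤ Q s s'} with hc
  have hc0 : 0 < c := ENNReal.toReal_pos (productDirichlet_dominating_pos hγ (kernelMatrix_nonneg P)
    (sum_kernelMatrix P) (sq_nonneg θ) (pow_lt_one₀ hθ0.le hθ1 two_ne_zero)).ne'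
    (measure_ne_top _ _)
  have hsc : 0 < √c := Real.sqrt_pos.mpr hc0
  have hM : 1 ≤ C / √c := by
    rw [one_le_div hsc]
    exact (Real.sqrt_le_one.mpr measureReal_le_one).trans hC
  obtain ⟨K, hK⟩ := exists_tsum_min_one_le hM hr'0 hr'
  refine ⟨K, fun μ _ ρ hρ0 hρ1 => le_trans ?_ (hK ρ hρ0 hρ1)⟩
  have hsρ : 0 < √ρ := Real.sqrt_pos.mpr hρ0
  set W : ℕ → (ℕ → S) → ℝ≥0∞ := fun n ω =>
    ∏ t ∈ Finset.range n, ENNReal.ofReal (sqrtInvLR P P₀ (ω t) (ω (t + 1))) with hW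
  have hWm : ∀ n, Measurable (W n) := fun n =>
    measurable_of_dependsOn_Iic
      (dependsOn_prod_range (fun a b => ENNReal.ofReal (sqrtInvLR P P₀ a b)) n)
  set κ : ℕ → ℝ := fun n => (√c * √ρ * θ ^ n)⁻¹ with hκ
  have hκ0 : ∀ n, 0 < κ n := fun n => by positivity
  have hWint : ∀ n, ∫⁻ ω, W n ω ∂chainLaw μ P ≤ ENNReal.ofReal (C * r ^ n) := fun n => by
    have h := lintegral_chainLaw_prod_sqrtInvLR μ P P₀ n (u := 1) (fun _ => zero_le_one)
    simp only [Pi.one_apply, ENNReal.ofReal_one, mul_one] at h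
    rw [hW, h]
    refine (lintegral_mono (g := fun _ => ENNReal.ofReal (C * r ^ n)) fun ω : ℕ → S =>
      ENNReal.ofReal_le_ofReal (hdecay n (ω 0))).trans ?_
    simp
  calc ∫⁻ ω, (rejectionTime P₀ (productDirichlet γ) ρ ω : ℝ≥0∞) ∂(chainLaw μ P)
      ≤ ∫⁻ ω, ∑' n, min 1 (ENNReal.ofReal (κ n) * W n ω) ∂(chainLaw μ P) := by
        refine lintegral_mono_ae ?_
        filter_upwards [ae_chainLaw_transition_ne_zero μ P] with ω hω
        refine (toENNReal_le_tsum _).trans (ENNReal.tsum_le_tsum fun n => ?_)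
        split_ifs with hn
        · have h := sqrt_mul_pow_le_prod_of_lt_rejectionTime P P₀ _ hθ0.le hρ0 hρ1 hω hn
          refine le_min le_rfl ?_
          simp only [hW]
          rw [← ENNReal.ofReal_prod_of_nonneg fun t _ => sqrtInvLR_nonneg P P₀ _ _,
            ← ENNReal.ofReal_mul (hκ0 n).le, ENNReal.one_le_ofReal, hκ, inv_mul_eq_div,
            one_le_div (by positivity)]
          exact h
        · exact zero_le
    _ = ∑' n, ∫⁻ ω, min 1 (ENNReal.ofReal (κ n) * W n ω) ∂(chainLaw μ P) :=
        lintegral_tsum fun n => (measurable_const.min ((hWm n).const_mul _)).aemeasurable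
    _ ≤ ∑' n, min 1 (ENNReal.ofReal (C / √c / √ρ * r' ^ n)) := by
        refine ENNReal.tsum_le_tsum fun n => le_min ?_ ?_
        · exact (lintegral_mono fun ω => min_le_left _ _).trans (by simp)
        · calc ∫⁻ ω, min 1 (ENNReal.ofReal (κ n) * W n ω) ∂(chainLaw μ P)
              ≤ ∫⁻ ω, ENNReal.ofReal (κ n) * W n ω ∂(chainLaw μ P) :=
                lintegral_mono fun ω => min_le_right _ _
            _ = ENNReal.ofReal (κ n) * ∫⁻ ω, W n ω ∂(chainLaw μ P) :=
                lintegral_const_mul _ (hWm n)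
            _ ≤ ENNReal.ofReal (κ n) * ENNReal.ofReal (C * r ^ n) := by gcongr; exact hWint n
            _ = ENNReal.ofReal (C / √c / √ρ * r' ^ n) := by
                rw [← ENNReal.ofReal_mul (hκ0 n).le]
                congr 1
                have hrθ : r = θ * r' := (div_mul_cancel₀ r hr'0.ne').symm
                rw [hrθ, mul_pow]
                simp only [hκ]
                field_simp

end Power

end MarkovTest

theorem theorem2 {S : Type*} [Fintype S] [MeasurableSpace S] [DiscreteMeasurableSpace S]
    (γ : S → S → ℝ) (hγ : ∀ s s', 0 < γ s s')
    (P₀ : Kernel S S) [IsMarkovKernel P₀] (C₀ : Set S)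
    (hC₀ : MarkovTest.closedClasses P₀ = {C₀}) :
    (∀ (μ : Measure S) [IsProbabilityMeasure μ] (ρ : ℝ), 0 < ρ → ρ < 1 →
      MarkovTest.chainLaw μ P₀
        {ω | MarkovTest.rejectionTime P₀ (MarkovTest.productDirichlet γ) ρ ω < ⊤}
          ≤ ENNReal.ofReal ρ) ∧
    (∀ (P : Kernel S S) [IsMarkovKernel P],
      MarkovTest.subKernel P C₀ ≠ MarkovTest.subKernel P₀ C₀ →
      ∃ K : ℝ, ∀ (μ : Measure S) [IsProbabilityMeasure μ] (ρ : ℝ), 0 < ρ → ρ < 1 →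
        ∫⁻ ω, (MarkovTest.rejectionTime P₀ (MarkovTest.productDirichlet γ) ρ ω : ℝ≥0∞)
            ∂(MarkovTest.chainLaw μ P)
          ≤ ENNReal.ofReal (K * (Real.log (1 / ρ) + 1))) := by
  have := MarkovTest.isProbabilityMeasure_productDirichlet hγ
  exact ⟨fun μ _ ρ hρ _ => MarkovTest.chainLaw_rejectionTime_lt_top_le μ P₀
      (MarkovTest.ae_productDirichlet_sum_ofReal_le_one hγ) hρ,
    fun P _ hne => MarkovTest.exists_lintegral_rejectionTime_le hγ P P₀ hC₀ hne⟩
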